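/- Let $\mathcal S$ be a finite set and $M=(m_{ss'})$ a Coxeter matrix over $\mathcal S$ (symmetric, entries in $\mathbb N\cup\{\infty\}$, $m_{ss}=1$, $m_{ss'}\ge 2$ for $s\ne s'$). Let $\mathrm{Br}(\mathcal S)$ be the associated Artin–Brieskorn braid group, generated by $\mathcal S$ subject to the relations $\underbrace{ss's\cdots}_{m_{ss'}}=\underbrace{s'ss'\cdots}_{m_{ss'}}$ for $s\neq s'$ with $m_{ss'}<\infty$; let $W(\mathcal S)$ be the Coxeter group obtained by adding the relations $s^2=1$ for $s\in\mathcal S$; let $\pi:\mathrm{Br}(\mathcal S)\to W(\mathcal S)$ be the projection and $P(\mathcal S)=\ker\pi$ the pure braid group, with abelianisation $P_{ab}(\mathcal S)$. Let $T(\mathcal S)\subset W(\mathcal S)$ be the set of quasireflections (conjugates in $W(\mathcal S)$ of elements of $\mathcal S$), and call the conjugates in $\mathrm{Br}(\mathcal S)$ of elements of $\mathcal S$ quasigenerators. The group $W(\mathcal S)$ acts on $P_{ab}(\mathcal S)$ by conjugation with lifts to $\mathrm{Br}(\mathcal S)$. For a subgroup $G$ of $W(\mathcal S)$ let $P_{ab}(\mathcal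 S)_G$ be the group of coinvariants, i.e. the quotient of $P_{ab}(\mathcal S)$ by the subgroup generated by the elements $w*A-A$, $w\in G$, $A\in P_{ab}(\mathcal S)$, and let $[x]_G$ denote the image in it of $x\in P(\mathcal S)$. Let $G$ be any subgroup of $W(\mathcal S)$. Then $P_{ab}(\mathcal S)_G$ is a free abelian group with a basis $(A_{G\cdot t})$ indexed by the orbits $G\cdot t$ of $G$ acting on $T(\mathcal S)$ by conjugation, where $A_{G\cdot t}=[\,y s^2 y^{-1}]_G$ for all $y\in\mathrm{Br}(\mathcal S)$ and $s\in\mathcal S$ with $\pi(ysy^{-1})=t$. Moreover, let $x\in P(\mathcal S)$ be an element that can be represented as a finite product $$x=\prod_i \hat t_i^{\,\epsilon_i}\cdot\prod_j [x_{2j-1},x_{2j}],$$ where the $\hat t_i$ are quasigenerators, $\epsilon_i=\pm1$, $x_j\in\mathrm{Br}(\mathcal S)$, and $\pi(\hat t_i)\in G$, $\pi(x_j)\in G$ for all $i,j$. Then $[x]_G$ lies in the free abelian subgroup of $P_{ab}(\mathcal S)_G$ generated by the basis elements $A_{G\cdot t}$ with $t\in G\cap T(\mathcal S)$. -/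

import Mathlib

namespace ArtinBraid

variable {S : Type*} (M : CoxeterMatrix S)

/-- The element `⋯ s_i s_j` of the free group on `S`: the alternating word of length `m_{ij}`
in `i` and `j` that ends with `j`. -/
def braidSide (i j : S) : FreeGroup S :=
  ((CoxeterSystem.braidWord M i j).map FreeGroup.of).prod

/-- The braid relators: for all `i ≠ j` with `m_{ij} < ∞` (an infinite entry is encoded as `0`),
the two alternating words of length `m_{ij}` in `i` and `j` are equal. -/
def braidRelators : Set (FreeGroup S) :=
  {r | ∃ i j : S, i ≠ j ∧ M i j ≠ 0 ∧ r = braidSide M i j * (braidSide M j i)⁻¹}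

/-- The Artin--Brieskorn braid group `Br(S)` of a Coxeter matrix. -/
abbrev Braid : Type _ := PresentedGroup (braidRelators M)

/-- The standard generators of the braid group. -/
def gen (s : S) : Braid M := PresentedGroup.of s

theorem lift_relators (r : FreeGroup S) (hr : r ∈ braidRelators M) :
    FreeGroup.lift M.simple r = 1 := by
  obtain ⟨i, j, -, -, rfl⟩ := hr
  have h : ∀ i j : S, FreeGroup.lift M.simple (braidSide M i j)
      = M.toCoxeterSystem.wordProd (CoxeterSystem.braidWord M i j) := by
    intro i j
    simp [braidSide, CoxeterSystem.wordProd, map_list_prod, List.map_map, Function.comp_def,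
      CoxeterMatrix.toCoxeterSystem_simple]
  rw [map_mul, map_inv, h, h, CoxeterSystem.wordProd_braidWord_eq, mul_inv_cancel]

/-- The natural projection `π : Br(S) → W(S)`, sending each generator to the simple reflection. -/
def proj : Braid M →* M.Group := PresentedGroup.toGroup (lift_relators M)

@[simp]
theorem proj_gen (s : S) : proj M (gen M s) = M.simple s :=
  PresentedGroup.toGroup.of (lift_relators M)

theorem proj_surjective : Function.Surjective (proj M) := by
  intro w
  obtain ⟨v, rfl⟩ := PresentedGroup.mk_surjective _ w
  induction v using FreeGroup.induction_on with
  | C1 => exact ⟨1, by rw [map_one, map_one]; rfl⟩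
  | of s => exact ⟨gen M s, proj_gen M s⟩
  | inv_of s _ => exact ⟨(gen M s)⁻¹, by rw [map_inv, proj_gen, map_inv]; rfl⟩
  | mul a b ha hb =>
    obtain ⟨x, hx⟩ := ha
    obtain ⟨y, hy⟩ := hb
    exact ⟨x * y, by rw [map_mul, hx, hy, map_mul]; rfl⟩

/-- A quasigenerator of `Br(S)`: a conjugate of a standard generator. -/
def IsQuasigenerator (x : Braid M) : Prop := ∃ (y : Braid M) (s : S), x = y * gen M s * y⁻¹

/-- The set `T(S)` of quasireflections of `W(S)`: the conjugates of the standard generators. -/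
def Quasireflection : Type _ := {t : M.Group // M.toCoxeterSystem.IsReflection t}

/-- `W(S)` acts on `T(S)` by conjugation. -/
instance : MulAction M.Group (Quasireflection M) where
  smul w t := ⟨w * t.1 * w⁻¹, t.2.conj w⟩
  one_smul t := Subtype.ext (by change 1 * t.1 * 1⁻¹ = t.1; simp)
  mul_smul v w t := Subtype.ext (by
    change (v * w) * t.1 * (v * w)⁻¹ = v * (w * t.1 * w⁻¹) * v⁻¹
    group)

/-- The set `T(S) / G` of orbits of a subgroup `G` of `W(S)` acting on `T(S)` by conjugation. -/
abbrev Orbits (G : Subgroup M.Group) : Type _ := MulAction.orbitRel.Quotient G (Quasireflection M)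

/-- The orbit `G · t`. -/
def orbitOf (G : Subgroup M.Group) (t : Quasireflection M) : Orbits M G := Quotient.mk _ t

/-- The pure braid group `P(S)`. -/
abbrev PureBraid : Subgroup (Braid M) := (proj M).ker

/-- The abelianisation `P_ab(S)`, written additively. -/
abbrev PureAb : Type _ := Additive (Abelianization (PureBraid M))

/-- The class in `P_ab(S)` of an element of `P(S)`. -/
def pureClass (p : PureBraid M) : PureAb M := Additive.ofMul (Abelianization.of p)

/-- The action of `Br(S)` on (multiplicative) `P_ab(S)` induced by conjugation. -/
def braidConj : Braid M →* MulAut (Abelianization (PureBraid M)) where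
  toFun y := (MulAut.conjNormal y).abelianizationCongr
  map_one' := by rw [map_one]; exact abelianizationCongr_refl
  map_mul' x y := by
    rw [map_mul]
    exact (abelianizationCongr_trans _ _).symm

theorem braidConj_of (y : Braid M) (p : PureBraid M) :
    braidConj M y (Abelianization.of p) = Abelianization.of (MulAut.conjNormal y p) := rfl

theorem ker_le : (proj M).ker ≤ (braidConj M).ker := by
  intro y hy
  rw [MonoidHom.mem_ker]
  ext a
  obtain ⟨p, rfl⟩ := QuotientGroup.mk_surjective a
  change braidConj M y (Abelianization.of p) = Abelianization.of p
  rw [braidConj_of]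
  have h : MulAut.conjNormal y p = (⟨y, hy⟩ : PureBraid M) * p * (⟨y, hy⟩ : PureBraid M)⁻¹ :=
    Subtype.ext (by simp)
  rw [h, map_mul, map_mul, map_inv, mul_comm, inv_mul_cancel_left]

/-- The conjugation action of `W(S)` on (multiplicative) `P_ab(S)`; it is well defined because
`P(S)` acts trivially on its abelianisation. -/
noncomputable def weylConj : M.Group →* MulAut (Abelianization (PureBraid M)) :=
  (proj M).liftOfSurjective (proj_surjective M) ⟨braidConj M, ker_le M⟩

theorem weylConj_proj (y : Braid M) : weylConj M (proj M y) = braidConj M y :=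
  MonoidHom.liftOfRightInverse_comp_apply _ _ _ ⟨braidConj M, ker_le M⟩ y

/-- The conjugation action of `W(S)` on `P_ab(S)`, as an integral representation. -/
noncomputable def weylRep : Representation ℤ M.Group (PureAb M) where
  toFun w := (MonoidHom.toAdditive (weylConj M w).toMonoidHom).toIntLinearMap
  map_one' := by rw [map_one]; rfl
  map_mul' v w := by rw [map_mul]; rfl

theorem weylRep_proj (y : Braid M) (p : PureBraid M) :
    weylRep M (proj M y) (pureClass M p) = pureClass M (MulAut.conjNormal y p) := by
  change Additive.ofMul (weylConj M (proj M y) (Abelianization.of p)) = _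
  rw [weylConj_proj, braidConj_of]
  rfl

/-- The group of coinvariants `P_ab(S)_G`, the quotient of `P_ab(S)` by the subgroup generated by
all `w * A - A` with `w ∈ G`. -/
abbrev PureCoinv (G : Subgroup M.Group) : Type _ :=
  Representation.Coinvariants ((weylRep M).comp G.subtype)

/-- The projection `[x]_G` of `x ∈ P(S)` to `P_ab(S)_G`. -/
noncomputable def coinvClass (G : Subgroup M.Group) (x : PureBraid M) : PureCoinv M G :=
  Representation.Coinvariants.mk ((weylRep M).comp G.subtype) (pureClass M x)

/-- The element `y s² y⁻¹` of `P(S)`. -/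
def conjSq (y : Braid M) (s : S) : PureBraid M :=
  ⟨y * gen M s ^ 2 * y⁻¹, by
    have h : M.simple s ^ 2 = 1 := by
      simpa [CoxeterMatrix.toCoxeterSystem_simple] using M.toCoxeterSystem.simple_sq s
    rw [MonoidHom.mem_ker, map_mul, map_mul, map_pow, map_inv, proj_gen, h]
    simp⟩

/-- `A` is the natural basis `(A_{G · t})` of `P_ab(S)_G`, indexed by `T(S) / G`: if a
quasireflection `t` is the projection of `y s y⁻¹` with `y ∈ Br(S)` and `s ∈ S`, then `A_{G · t}`
is the class of `y s² y⁻¹`. Every `t ∈ T(S)` has this form, so at most one `A` satisfies this. -/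
def IsNaturalBasis (G : Subgroup M.Group) (A : Module.Basis (Orbits M G) ℤ (PureCoinv M G)) :
    Prop :=
  ∀ (t : Quasireflection M) (y : Braid M) (s : S), t.1 = proj M (y * gen M s * y⁻¹) →
    A (orbitOf M G t) = coinvClass M G (conjSq M y s)

end ArtinBraid

/-! Let `W(S)` permute a set `X` of "walls", and give each generator `s` a wall `α s`, compatibly
with conjugation in `Br(S)`. Letting `s` act on `ℤ[X]` by `f ↦ α s + s f` defines an affine action
of `Br(S)`: the two sides of a braid relation meet the same walls in opposite orders
(`wallSeq_reverse`). Its translation part `cross` is a 1-cocycle counting signed crossings. It is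
additive on `P(S)` and equals `2 · π(y) α s` at `y s² y⁻¹`.

The cocycle is used twice. With `X = P_ab(S)` as a mere set and `α s = [s²]`, a parity argument
(`wall_eq_of_proj_eq`) shows that `[y s² y⁻¹]` depends only on `π(y s y⁻¹)`. With `X = T(S)`,
pushing forward to orbits gives a homomorphism `π⁻¹(G) → ℤ[T(S)/G]` that descends to the
coinvariants and sends the candidate for `A_{G·t}` to twice the orbit `G·t`; this gives
independence. Spanning holds because `P(S)` is the normal closure of the squares `s²`.

So the crossing number is twice the coordinate vector. A quasigenerator over `t ∈ G` contributes
only the orbit of `t`, and commutators contribute nothing, which yields the last assertion. -/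

namespace ArtinBraid

/-! ### Alternating products in a group -/

section AlternatingProduct

variable {H : Type*} [Group H]

/-- The alternating product `x y x ⋯` with `n` factors, starting with `x`. -/
def altProd : H → H → ℕ → H
  | _, _, 0 => 1
  | x, y, n + 1 => x * altProd y x n

theorem altProd_succ' (x y : H) (n : ℕ) :
    altProd x y (n + 1) = altProd x y n * (if Even n then x else y) := by
  induction n generalizing x y with
  | zero => simp [altProd]
  | succ n ih =>
    rw [altProd, ih, altProd, mul_assoc]
    by_cases h : Even n <;> simp [h, Nat.even_add_one]

theorem map_altProd {K : Type*} [Group K] (f : H →* K) (x y : H) (n : ℕ) :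
    f (altProd x y n) = altProd (f x) (f y) n := by
  induction n generalizing x y with
  | zero => simp [altProd]
  | succ n ih => rw [altProd, map_mul, ih, altProd]

/-- For involutions `x` and `y`, the two alternating products of length `n` differ by `(x y) ^ n`. -/
theorem altProd_mul_altProd_inv {x y : H} (hx : x * x = 1) (hy : y * y = 1) (n : ℕ) :
    altProd x y n * (altProd y x n)⁻¹ = (x * y) ^ n := by
  have hy' : y⁻¹ = y := inv_eq_of_mul_eq_one_left hy
  induction n generalizing x y with
  | zero => simp [altProd]
  | succ n ih =>
    have hx' : x⁻¹ = x := inv_eq_of_mul_eq_one_left hx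
    have h := ih hy hx hx'
    calc altProd x y (n + 1) * (altProd y x (n + 1))⁻¹
        = x * (altProd y x n * (altProd x y n)⁻¹) * y := by
          rw [altProd, altProd, mul_inv_rev, hy']; group
      _ = (x * y) ^ (n + 1) := by
          rw [h, ← mul_pow_mul, mul_assoc, pow_succ]

/-- The alternating word is specified by its last letter and `altProd` by its first, so the parity
of the length decides which letter leads. -/
theorem prod_map_alternatingWord {S : Type*} (f : S → H) (i j : S) (n : ℕ) :
    ((CoxeterSystem.alternatingWord i j n).map f).prod =
      if Even n then altProd (f i) (f j) n else altProd (f j) (f i) n := by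
  induction n generalizing i j with
  | zero => simp [altProd, CoxeterSystem.alternatingWord]
  | succ n ih =>
    rw [CoxeterSystem.alternatingWord_succ, List.concat_eq_append, List.map_append,
      List.prod_append, ih]
    by_cases h : Even n <;> simp [h, Nat.even_add_one, altProd_succ']

end AlternatingProduct

/-! ### Braid relations, and generators of the pure braid group -/

section Presentation

variable {S : Type*} (M : CoxeterMatrix S)

theorem map_braidSide {H : Type*} [Group H] (f : S → H) (i j : S) :
    FreeGroup.lift f (braidSide M i j) =
      if Even (M i j) then altProd (f i) (f j) (M i j) else altProd (f j) (f i) (M i j) := by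
  rw [← prod_map_alternatingWord, braidSide, map_list_prod, List.map_map]
  simp [Function.comp_def, CoxeterSystem.braidWord]

theorem lift_braidRelators {H : Type*} [Group H] {f : S → H}
    (hf : ∀ i j, i ≠ j → M i j ≠ 0 → altProd (f i) (f j) (M i j) = altProd (f j) (f i) (M i j))
    (r : FreeGroup S) (hr : r ∈ braidRelators M) : FreeGroup.lift f r = 1 := by
  obtain ⟨i, j, hij, h0, rfl⟩ := hr
  rw [map_mul, map_inv, map_braidSide, map_braidSide, mul_inv_eq_one, M.symmetric j i,
    hf i j hij h0]

theorem altProd_gen {i j : S} (hij : i ≠ j) (h0 : M i j ≠ 0) :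
    altProd (gen M i) (gen M j) (M i j) = altProd (gen M j) (gen M i) (M i j) := by
  have h : PresentedGroup.mk (braidRelators M) (braidSide M i j * (braidSide M j i)⁻¹) = 1 :=
    (QuotientGroup.eq_one_iff _).2 (Subgroup.subset_normalClosure ⟨i, j, hij, h0, rfl⟩)
  have hl : PresentedGroup.mk (braidRelators M) = FreeGroup.lift (gen M) := by
    ext s; simp [gen, PresentedGroup.of]
  rw [hl, map_mul, map_inv, map_braidSide, map_braidSide, mul_inv_eq_one, M.symmetric j i] at h
  split_ifs at h
  · exact h
  · exact h.symm

/-- The pure braid group is the normal closure of the squares of the generators. -/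
theorem pureBraid_eq_normalClosure :
    PureBraid M = Subgroup.normalClosure (Set.range fun s => gen M s ^ 2) := by
  set N := Subgroup.normalClosure (Set.range fun s => gen M s ^ 2) with hN
  have hsq : ∀ s, (gen M s : Braid M ⧸ N) * (gen M s : Braid M ⧸ N) = 1 := fun s => by
    rw [← QuotientGroup.mk_mul, QuotientGroup.eq_one_iff, ← pow_two]
    exact Subgroup.subset_normalClosure ⟨s, rfl⟩
  apply le_antisymm
  · have hrel : ∀ r ∈ M.relationsSet,
        FreeGroup.lift (fun s => (gen M s : Braid M ⧸ N)) r = 1 := by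
      rintro _ ⟨⟨i, j⟩, rfl⟩
      simp only [Function.uncurry_apply_pair, CoxeterMatrix.relation, map_pow, map_mul,
        FreeGroup.lift_apply_of]
      by_cases hij : i = j
      · subst hij; rw [hsq, one_pow]
      by_cases h0 : M i j = 0
      · rw [h0, pow_zero]
      rw [← altProd_mul_altProd_inv (hsq i) (hsq j), mul_inv_eq_one]
      have h := congrArg (QuotientGroup.mk' N) (altProd_gen M hij h0)
      rw [map_altProd, map_altProd] at h
      exact h
    -- Modulo `N` the generators are involutions, so the braid relations become the Coxeter
    -- relations. Hence the quotient map by `N` factors through `proj M`, and the kernel of `proj M`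
    -- lies in `N`.
    let back : M.Group →* Braid M ⧸ N := PresentedGroup.toGroup hrel
    have hback : back.comp (proj M) = QuotientGroup.mk' N := by
      ext s
      change back (proj M (gen M s)) = _
      rw [proj_gen]
      exact PresentedGroup.toGroup.of hrel
    intro y hy
    rw [← QuotientGroup.eq_one_iff]
    change QuotientGroup.mk' N y = 1
    rw [← hback, MonoidHom.comp_apply, MonoidHom.mem_ker.1 hy, map_one]
  · refine Subgroup.normalClosure_le_normal ?_
    rintro _ ⟨s, rfl⟩
    simpa [conjSq] using (conjSq M 1 s).2

theorem pureBraid_induction {p : Braid M → Prop} (sq : ∀ y s, p (y * gen M s ^ 2 * y⁻¹))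
    (one : p 1) (mul : ∀ x y, x ∈ PureBraid M → y ∈ PureBraid M → p x → p y → p (x * y))
    (inv : ∀ x, x ∈ PureBraid M → p x → p x⁻¹) {x : Braid M} (hx : x ∈ PureBraid M) : p x := by
  have hle : ∀ {x}, x ∈ Subgroup.closure (Group.conjugatesOfSet (Set.range fun s => gen M s ^ 2)) →
      x ∈ PureBraid M := fun {x} h => by
    rw [pureBraid_eq_normalClosure]; exact h
  rw [pureBraid_eq_normalClosure] at hx
  induction hx using Subgroup.closure_induction with
  | mem x hx =>
    obtain ⟨_, ⟨s, rfl⟩, hc⟩ := Group.mem_conjugatesOfSet_iff.1 hx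
    obtain ⟨y, rfl⟩ := isConj_iff.1 hc
    exact sq y s
  | one => exact one
  | mul x y hx hy px py => exact mul x y (hle hx) (hle hy) px py
  | inv x hx px => exact inv x (hle hx) px

end Presentation

/-! ### Walls met along an alternating path -/

section Crossing

variable {S : Type*} (M : CoxeterMatrix S) {X : Type*} (a : M.Group →* Equiv.Perm X) (α : S → X)

/-- `α` is compatible with the action `a` if conjugate generators of the braid group have
correspondingly related values. -/
def Compatible : Prop :=
  ∀ (y : Braid M) (s s' : S), y * gen M s * y⁻¹ = gen M s' → a (proj M y) (α s) = α s'

/-- The walls met by the path `i j i ⋯`. -/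
def wallSeq : S → S → ℕ → X
  | i, _, 0 => α i
  | i, j, n + 1 => a (M.simple i) (wallSeq j i n)

theorem wallSeq_eq (i j : S) (n : ℕ) :
    wallSeq M a α i j n =
      a (proj M (altProd (gen M i) (gen M j) n)) (α (if Even n then i else j)) := by
  induction n generalizing i j with
  | zero => simp [wallSeq, altProd]
  | succ n ih =>
    rw [wallSeq, ih, altProd, map_mul, map_mul, proj_gen, Equiv.Perm.mul_apply]
    by_cases h : Even n <;> simp [h, Nat.even_add_one]

theorem simple_mul_self (s : S) : M.simple s * M.simple s = 1 := by
  simpa [CoxeterMatrix.toCoxeterSystem_simple] using M.toCoxeterSystem.simple_mul_simple_self s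

variable {M a α}

/-- The two sides of a braid relation meet the same walls in opposite orders. This is what makes the
affine action well defined. -/
theorem wallSeq_reverse (h : Compatible M a α) {m : ℕ} {i j : S}
    (hm : altProd (gen M i) (gen M j) m = altProd (gen M j) (gen M i) m) {k l : ℕ}
    (hkl : k + l + 1 = m) : wallSeq M a α i j k = wallSeq M a α j i l := by
  induction k generalizing i j l with
  | zero =>
    obtain rfl : m = l + 1 := by omega
    rw [wallSeq, wallSeq_eq]
    refine (h _ _ _ ?_).symm
    -- Peeling the first letter off one side and the last off the other shows that the alternating
    -- product of length `l` conjugates the last letter to `gen M i`, so compatibility applies.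
    rw [altProd_succ' (gen M j), altProd, ← apply_ite (gen M)] at hm
    rw [← hm, mul_inv_cancel_right]
  | succ k ih =>
    rw [wallSeq, ih hm.symm (l := l + 1) (by omega), wallSeq, ← Equiv.Perm.mul_apply, ← map_mul,
      simple_mul_self, map_one, Equiv.Perm.one_apply]

end Crossing
-- The affine action and the crossing cocycle
section Cross

variable {S : Type*} (M : CoxeterMatrix S) {X : Type*} (a : M.Group →* Equiv.Perm X) (α : S → X)

/-- The action on integral combinations of walls. -/
noncomputable def shift (w : M.Group) : (X →₀ ℤ) →+ (X →₀ ℤ) :=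
  Finsupp.mapDomain.addMonoidHom (a w)

@[simp]
theorem shift_single (w : M.Group) (x : X) (n : ℤ) :
    shift M a w (Finsupp.single x n) = Finsupp.single (a w x) n :=
  Finsupp.mapDomain_single

theorem shift_one (f : X →₀ ℤ) : shift M a 1 f = f := by
  change Finsupp.mapDomain (a 1) f = f
  rw [map_one]
  exact Finsupp.mapDomain_id

theorem shift_mul (v w : M.Group) (f : X →₀ ℤ) :
    shift M a (v * w) f = shift M a v (shift M a w f) := by
  change Finsupp.mapDomain (a (v * w)) f = Finsupp.mapDomain (a v) (Finsupp.mapDomain (a w) f)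
  rw [← Finsupp.mapDomain_comp, map_mul]
  rfl

theorem shift_apply (w : M.Group) (f : X →₀ ℤ) (x : X) : shift M a w f (a w x) = f x :=
  Finsupp.mapDomain_apply (a w).injective f x

/-- The affine permutation of integral combinations of walls by which a generator acts. -/
noncomputable def genPerm (s : S) : Equiv.Perm (X →₀ ℤ) where
  toFun f := Finsupp.single (α s) 1 + shift M a (M.simple s) f
  invFun f := shift M a (M.simple s) (f - Finsupp.single (α s) 1)
  left_inv f := by
    change shift M a (M.simple s) (_ + _ - _) = f
    rw [add_sub_cancel_left, ← shift_mul, simple_mul_self, shift_one]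
  right_inv f := by
    change _ + shift M a (M.simple s) (shift M a (M.simple s) _) = f
    rw [← shift_mul, simple_mul_self, shift_one, add_sub_cancel]

theorem genPerm_apply (s : S) (f : X →₀ ℤ) :
    genPerm M a α s f = Finsupp.single (α s) 1 + shift M a (M.simple s) f := rfl

theorem altProd_genPerm_apply (i j : S) (n : ℕ) (f : X →₀ ℤ) :
    altProd (genPerm M a α i) (genPerm M a α j) n f =
      ∑ k ∈ Finset.range n, Finsupp.single (wallSeq M a α i j k) 1 +
        shift M a (proj M (altProd (gen M i) (gen M j) n)) f := by
  induction n generalizing i j with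
  | zero => simp [altProd, shift_one]
  | succ n ih =>
    rw [altProd, Equiv.Perm.mul_apply, ih, genPerm_apply, map_add, map_sum, ← shift_mul, altProd,
      map_mul, proj_gen, Finset.sum_range_succ']
    simp only [shift_single, wallSeq]
    abel

variable {a α}

theorem altProd_genPerm (h : Compatible M a α) (i j : S) (hij : i ≠ j) (h0 : M i j ≠ 0) :
    altProd (genPerm M a α i) (genPerm M a α j) (M i j) =
      altProd (genPerm M a α j) (genPerm M a α i) (M i j) := by
  have hm := altProd_gen M hij h0
  ext1 f
  -- The linear parts agree by the braid relation; the translation parts are sums over the same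
  -- walls, read in reverse.
  rw [altProd_genPerm_apply, altProd_genPerm_apply, hm,
    ← Finset.sum_range_reflect (fun k => Finsupp.single (wallSeq M a α j i k) (1 : ℤ))]
  congr 1
  refine Finset.sum_congr rfl fun k hk => ?_
  rw [Finset.mem_range] at hk
  rw [wallSeq_reverse h hm (l := M i j - 1 - k) (by omega)]

/-- The affine action of the braid group on integral combinations of walls. -/
noncomputable def crossHom (h : Compatible M a α) : Braid M →* Equiv.Perm (X →₀ ℤ) :=
  PresentedGroup.toGroup (lift_braidRelators M (altProd_genPerm M h))

theorem crossHom_gen (h : Compatible M a α) (s : S) :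
    crossHom M h (gen M s) = genPerm M a α s :=
  PresentedGroup.toGroup.of _

variable {M}

/-- The number of times, counted with sign, that a braid crosses each wall. -/
noncomputable def cross (h : Compatible M a α) (y : Braid M) : X →₀ ℤ := crossHom M h y 0

theorem closure_range_gen : Subgroup.closure (Set.range (gen M)) = ⊤ :=
  PresentedGroup.closure_range_of _

variable (h : Compatible M a α)

/-- Each braid acts affinely with linear part `shift`, so composing two actions gives the cocycle
rule `cross_mul`. -/
theorem crossHom_apply (y : Braid M) (f : X →₀ ℤ) :
    crossHom M h y f = cross h y + shift M a (proj M y) f := by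
  have hy : y ∈ Subgroup.closure (Set.range (gen M)) := closure_range_gen ▸ Subgroup.mem_top y
  induction hy using Subgroup.closure_induction generalizing f with
  | mem y hy =>
    obtain ⟨s, rfl⟩ := hy
    simp [cross, crossHom_gen, genPerm_apply]
  | one => simp [cross, shift_one]
  | mul x y _ _ hx hy =>
    rw [cross, map_mul, Equiv.Perm.mul_apply, Equiv.Perm.mul_apply, hy, hy 0, hx, hx (_ + _),
      map_mul, shift_mul, map_add, map_add, map_zero, map_zero]
    abel
  | inv y _ hy =>
    have key : ∀ f, crossHom M h y⁻¹ f = shift M a (proj M y⁻¹) (f - cross h y) := fun f => by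
      have e : crossHom M h y (crossHom M h y⁻¹ f) = f := by
        rw [← Equiv.Perm.mul_apply, ← map_mul, mul_inv_cancel, map_one, Equiv.Perm.one_apply]
      rw [hy] at e
      rw [← e, add_sub_cancel_left, ← shift_mul, ← map_mul, inv_mul_cancel, map_one, shift_one]
      rw [e]
    rw [cross, key, key, ← map_add]
    congr 1
    abel

theorem cross_one : cross h (1 : Braid M) = 0 := by simp [cross]

theorem cross_mul (x y : Braid M) :
    cross h (x * y) = cross h x + shift M a (proj M x) (cross h y) := by
  rw [cross, map_mul, Equiv.Perm.mul_apply, crossHom_apply]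
  rfl

theorem cross_gen (s : S) : cross h (gen M s) = Finsupp.single (α s) 1 := by
  rw [cross, crossHom_gen, genPerm_apply, map_zero, add_zero]

theorem shift_cross_inv (y : Braid M) : shift M a (proj M y) (cross h y⁻¹) = -cross h y := by
  rw [eq_neg_iff_add_eq_zero, add_comm, ← cross_mul, mul_inv_cancel, cross_one]

theorem cross_conj (y x : Braid M) :
    cross h (y * x * y⁻¹) = cross h y + shift M a (proj M y) (cross h x) -
      shift M a (proj M (y * x * y⁻¹)) (cross h y) := by
  rw [cross_mul, cross_mul, sub_eq_add_neg, ← map_neg, ← shift_cross_inv h y, ← shift_mul,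
    ← map_mul, inv_mul_cancel_right]

theorem cross_of_mem_pure_mul {x : Braid M} (hx : x ∈ PureBraid M) (y : Braid M) :
    cross h (x * y) = cross h x + cross h y := by
  rw [cross_mul, MonoidHom.mem_ker.1 hx, shift_one]

theorem apply_simple_self (h : Compatible M a α) (s : S) : a (M.simple s) (α s) = α s := by
  simpa using h (gen M s) s s (by group)

theorem cross_conj_sq (y : Braid M) (s : S) :
    cross h (y * gen M s ^ 2 * y⁻¹) = Finsupp.single (a (proj M y) (α s)) 2 := by
  have h1 : proj M (y * gen M s ^ 2 * y⁻¹) = 1 := (conjSq M y s).2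
  rw [cross_conj, h1, shift_one, pow_two, cross_mul, cross_gen, proj_gen, shift_single,
    apply_simple_self h, ← Finsupp.single_add, shift_single]
  norm_num

/-- Crossing numbers are additive on pure braids, and each generator `y s² y⁻¹` crosses a single
wall twice. -/
theorem even_cross {x : Braid M} (hx : x ∈ PureBraid M) (b : X) : Even (cross h x b) := by
  refine pureBraid_induction M (p := fun x => Even (cross h x b)) (fun y s => ?_) ?_
    (fun x y hx _ px py => ?_) (fun x hx px => ?_) hx
  · classical
    rw [cross_conj_sq, Finsupp.single_apply]
    split_ifs <;> decide
  · simp [cross_one]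
  · rw [cross_of_mem_pure_mul h hx]
    exact px.add py
  · have e := shift_cross_inv h x
    rw [MonoidHom.mem_ker.1 hx, shift_one] at e
    rw [e]
    exact px.neg

/-- If two conjugate simple reflections agree in the Coxeter group, then so do the walls. -/
theorem wall_eq_of_proj_eq (h : Compatible M a α) {y : Braid M} {s s' : S}
    (hy : proj M (y * gen M s * y⁻¹) = M.simple s') : a (proj M y) (α s) = α s' := by
  classical
  -- The pure braid `p` measures the failure of `y s y⁻¹ = s'` in the braid group.
  set p := gen M s' * y * (gen M s)⁻¹ * y⁻¹ with hp
  have hpp : p ∈ PureBraid M := by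
    rw [MonoidHom.mem_ker]
    have e : p = gen M s' * (y * gen M s * y⁻¹)⁻¹ := by rw [hp]; group
    rw [e, map_mul, map_inv, hy, proj_gen, mul_inv_cancel]
  have e : cross h (gen M s' * y) = cross h (p * (y * gen M s)) := by rw [hp]; group
  rw [cross_of_mem_pure_mul h hpp, cross_mul, cross_mul h y, cross_gen, cross_gen, proj_gen,
    shift_single] at e
  -- At the wall `α s'`, fixed by `s'`, the contributions of `y` cancel. What remains is `1` on the
  -- left and an even number plus the multiplicity of `α s'` in the moved wall on the right; were
  -- the walls distinct, `1` would be even.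
  have e' := DFunLike.congr_fun e (α s')
  have hf : shift M a (M.simple s') (cross h y) (α s') = cross h y (α s') := by
    conv_lhs => rw [← apply_simple_self h s']
    exact shift_apply M a _ _ _
  simp only [Finsupp.add_apply, hf, Finsupp.single_eq_same] at e'
  by_contra hne
  rw [Finsupp.single_eq_of_ne (Ne.symm hne)] at e'
  obtain ⟨k, hk⟩ := even_cross h hpp (α s')
  omega

end Cross

/-! ### Classes of conjugated squares in the abelianised pure braid group -/

section PureAbelianization

variable {S : Type*} (M : CoxeterMatrix S)

/-- The action of the Coxeter group on the abelianised pure braid group, by permutations. -/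
noncomputable def pureAbPerm : M.Group →* Equiv.Perm (Abelianization (PureBraid M)) :=
  (MulAut.toPerm _).comp (weylConj M)

theorem pureAbPerm_proj (y : Braid M) (p : PureBraid M) :
    pureAbPerm M (proj M y) (Abelianization.of p) =
      Abelianization.of (MulAut.conjNormal y p) := by
  change weylConj M (proj M y) (Abelianization.of p) = _
  rw [weylConj_proj, braidConj_of]

theorem conjNormal_conjSq (x y : Braid M) (s : S) :
    MulAut.conjNormal x (conjSq M y s) = conjSq M (x * y) s :=
  Subtype.ext (by simp [conjSq, mul_assoc])

theorem compatible_pureAbPerm :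
    Compatible M (pureAbPerm M) fun s => Abelianization.of (conjSq M 1 s) := by
  intro y s s' hy
  rw [pureAbPerm_proj, conjNormal_conjSq]
  congr 1
  apply Subtype.ext
  simp [conjSq, ← hy, mul_one, conj_pow]

/-- The class of `y s² y⁻¹` only depends on the projection of `y s y⁻¹`. -/
theorem pureClass_conjSq_eq {y y' : Braid M} {s s' : S}
    (h : proj M (y * gen M s * y⁻¹) = proj M (y' * gen M s' * y'⁻¹)) :
    pureClass M (conjSq M y s) = pureClass M (conjSq M y' s') := by
  have hy : proj M (y'⁻¹ * y * gen M s * (y'⁻¹ * y)⁻¹) = M.simple s' := by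
    have e : y'⁻¹ * y * gen M s * (y'⁻¹ * y)⁻¹ = y'⁻¹ * (y * gen M s * y⁻¹) * y' := by group
    rw [e, map_mul, map_mul, h, ← map_mul, ← map_mul, ← proj_gen]
    congr 1
    group
  have e := wall_eq_of_proj_eq (compatible_pureAbPerm M) hy
  rw [pureAbPerm_proj, conjNormal_conjSq] at e
  -- The comparison was made after conjugating by `y'⁻¹`; acting by `y'` undoes this.
  have e' := congrArg (pureAbPerm M (proj M y')) e
  rw [pureAbPerm_proj, pureAbPerm_proj, conjNormal_conjSq, conjNormal_conjSq] at e'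
  simpa [pureClass] using e'

end PureAbelianization

/-! ### Crossing numbers of orbits of quasireflections -/

section Reflections

variable {S : Type*} (M : CoxeterMatrix S)

/-- The simple reflections, as quasireflections. -/
def simpleRefl (s : S) : Quasireflection M :=
  ⟨M.simple s, by
    simpa [CoxeterMatrix.toCoxeterSystem_simple] using M.toCoxeterSystem.isReflection_simple s⟩

theorem exists_smul_simpleRefl (t : Quasireflection M) :
    ∃ (y : Braid M) (s : S), t = proj M y • simpleRefl M s := by
  obtain ⟨w, s, h⟩ := t.2
  obtain ⟨y, rfl⟩ := proj_surjective M w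
  rw [CoxeterMatrix.toCoxeterSystem_simple] at h
  exact ⟨y, s, Subtype.ext h⟩

theorem eq_smul_simpleRefl_iff {t : Quasireflection M} {y : Braid M} {s : S} :
    t = proj M y • simpleRefl M s ↔ t.1 = proj M (y * gen M s * y⁻¹) := by
  rw [map_mul, map_mul, map_inv, proj_gen]
  exact ⟨fun h => congrArg Subtype.val h, fun h => Subtype.ext h⟩

theorem compatible_toPermHom :
    Compatible M (MulAction.toPermHom M.Group (Quasireflection M)) (simpleRefl M) := by
  intro y s s' hy
  refine (eq_smul_simpleRefl_iff M).2 ?_ |>.symm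
  rw [hy, proj_gen]
  rfl

variable (G : Subgroup M.Group)

theorem orbitOf_smul {w : M.Group} (hw : w ∈ G) (t : Quasireflection M) :
    orbitOf M G (w • t) = orbitOf M G t :=
  Quotient.sound ⟨⟨w, hw⟩, rfl⟩

/-- The signed number of crossings of a braid with each orbit of walls. -/
noncomputable def orbitCross (y : Braid M) : Orbits M G →₀ ℤ :=
  Finsupp.mapDomain (orbitOf M G) (cross (compatible_toPermHom M) y)

theorem mapDomain_orbitOf_shift {w : M.Group} (hw : w ∈ G) (f : Quasireflection M →₀ ℤ) :
    Finsupp.mapDomain (orbitOf M G) (shift M (MulAction.toPermHom M.Group _) w f) =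
      Finsupp.mapDomain (orbitOf M G) f := by
  change Finsupp.mapDomain (orbitOf M G) (Finsupp.mapDomain _ f) = _
  rw [← Finsupp.mapDomain_comp]
  exact congrArg (Finsupp.mapDomain · f) (funext fun t => orbitOf_smul M G hw t)

theorem orbitCross_one : orbitCross M G 1 = 0 := by
  rw [orbitCross, cross_one, Finsupp.mapDomain_zero]

/-- The twist in the cocycle rule is by an element of `G`, invisible on `G`-orbits; only the left
factor needs to lie over `G`. -/
theorem orbitCross_mul {x : Braid M} (hx : proj M x ∈ G) (y : Braid M) :
    orbitCross M G (x * y) = orbitCross M G x + orbitCross M G y := by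
  rw [orbitCross, cross_mul, Finsupp.mapDomain_add, mapDomain_orbitOf_shift M G hx]
  rfl

theorem orbitCross_inv {x : Braid M} (hx : proj M x ∈ G) :
    orbitCross M G x⁻¹ = -orbitCross M G x := by
  rw [eq_neg_iff_add_eq_zero, add_comm, ← orbitCross_mul M G hx, mul_inv_cancel, orbitCross_one]

theorem orbitCross_commutator {x y : Braid M} (hx : proj M x ∈ G) (hy : proj M y ∈ G) :
    orbitCross M G (x * y * x⁻¹ * y⁻¹) = 0 := by
  have hxy : proj M (x * y) ∈ G := by rw [map_mul]; exact mul_mem hx hy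
  have hx' : proj M x⁻¹ ∈ G := by rw [map_inv]; exact inv_mem hx
  rw [mul_assoc, orbitCross_mul M G hxy, orbitCross_mul M G hx, orbitCross_mul M G hx',
    orbitCross_inv M G hx, orbitCross_inv M G hy]
  abel

/-- The conjugator `y` need not lie over `G`: it contributes `cross y - t · cross y`, which dies on
orbits because `t ∈ G`. -/
theorem orbitCross_quasigenerator {t : Quasireflection M} {y : Braid M} {s : S}
    (ht : t.1 = proj M (y * gen M s * y⁻¹)) (hG : t.1 ∈ G) :
    orbitCross M G (y * gen M s * y⁻¹) = Finsupp.single (orbitOf M G t) 1 := by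
  rw [orbitCross, cross_conj, ← ht, cross_gen, shift_single, sub_eq_add_neg, ← map_neg,
    Finsupp.mapDomain_add, Finsupp.mapDomain_add, mapDomain_orbitOf_shift M G hG,
    Finsupp.mapDomain_single, add_right_comm, ← Finsupp.mapDomain_add, add_neg_cancel,
    Finsupp.mapDomain_zero, zero_add, (eq_smul_simpleRefl_iff M).2 ht]
  rfl

theorem orbitCross_conjSq (y : Braid M) (s : S) :
    orbitCross M G (conjSq M y s) =
      Finsupp.single (orbitOf M G (proj M y • simpleRefl M s)) 2 := by
  change Finsupp.mapDomain _ (cross _ (y * gen M s ^ 2 * y⁻¹)) = _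
  rw [cross_conj_sq, Finsupp.mapDomain_single]
  rfl

theorem orbitCross_conj {x y : Braid M} (hx : x ∈ PureBraid M) (hy : proj M y ∈ G) :
    orbitCross M G (y * x * y⁻¹) = orbitCross M G x := by
  have hx' : proj M x ∈ G := by rw [MonoidHom.mem_ker.1 hx]; exact one_mem G
  have hyx : proj M (y * x) ∈ G := by rw [map_mul]; exact mul_mem hy hx'
  rw [orbitCross_mul M G hyx, orbitCross_mul M G hy, orbitCross_inv M G hy]
  abel

/-- The crossing numbers, on the abelianised pure braid group. -/
noncomputable def pureAbCross : PureAb M →ₗ[ℤ] Orbits M G →₀ ℤ :=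
  (MonoidHom.toAdditiveLeft (Abelianization.lift
    ({ toFun := fun p => Multiplicative.ofAdd (orbitCross M G p)
       map_one' := by rw [Subgroup.coe_one, orbitCross_one]; rfl
       map_mul' := fun p q => by
        rw [Subgroup.coe_mul, orbitCross_mul M G
          (by rw [MonoidHom.mem_ker.1 p.2]; exact one_mem G)]
        rfl } : PureBraid M →* Multiplicative (Orbits M G →₀ ℤ)))).toIntLinearMap

theorem pureAbCross_pureClass (p : PureBraid M) :
    pureAbCross M G (pureClass M p) = orbitCross M G p := rfl

theorem exists_pureClass_eq (A : PureAb M) : ∃ p, pureClass M p = A := by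
  obtain ⟨p, hp⟩ := QuotientGroup.mk_surjective (Additive.toMul A)
  exact ⟨p, congrArg Additive.ofMul hp⟩

/-- The crossing numbers, on the coinvariants. -/
noncomputable def coinvCross : PureCoinv M G →ₗ[ℤ] Orbits M G →₀ ℤ :=
  Representation.Coinvariants.lift _ (pureAbCross M G) fun g => by
    apply LinearMap.ext
    intro A
    obtain ⟨p, rfl⟩ := exists_pureClass_eq M A
    obtain ⟨y, hy⟩ := proj_surjective M g
    change pureAbCross M G (weylRep M g (pureClass M p)) = _
    rw [← hy, weylRep_proj, pureAbCross_pureClass, pureAbCross_pureClass,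
      MulAut.conjNormal_apply, orbitCross_conj M G p.2 (hy ▸ g.2)]

theorem coinvCross_coinvClass (p : PureBraid M) :
    coinvCross M G (coinvClass M G p) = orbitCross M G p :=
  Representation.Coinvariants.lift_mk _ _ _ _

theorem coinvClass_one : coinvClass M G 1 = 0 := map_zero _

theorem coinvClass_mul (p q : PureBraid M) :
    coinvClass M G (p * q) = coinvClass M G p + coinvClass M G q :=
  map_add (Representation.Coinvariants.mk ((weylRep M).comp G.subtype))
    (pureClass M p) (pureClass M q)

theorem coinvClass_inv (p : PureBraid M) : coinvClass M G p⁻¹ = -coinvClass M G p :=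
  map_neg (Representation.Coinvariants.mk ((weylRep M).comp G.subtype)) (pureClass M p)

theorem coinvClass_conjNormal {y : Braid M} (hy : proj M y ∈ G) (p : PureBraid M) :
    coinvClass M G (MulAut.conjNormal y p) = coinvClass M G p := by
  rw [coinvClass, ← weylRep_proj]
  exact Representation.Coinvariants.mk_self_apply ((weylRep M).comp G.subtype) ⟨_, hy⟩ _

/-- Lift to a braid `x` the element of `G` relating the two quasireflections. Conjugation by `x` is
trivial on coinvariants and reduces the claim to equal quasireflections, where `pureClass_conjSq_eq`
applies. -/
theorem coinvClass_conjSq_eq {y y' : Braid M} {s s' : S}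
    (h : orbitOf M G (proj M y • simpleRefl M s) = orbitOf M G (proj M y' • simpleRefl M s')) :
    coinvClass M G (conjSq M y s) = coinvClass M G (conjSq M y' s') := by
  obtain ⟨⟨g, hg⟩, hgt⟩ := Quotient.exact h
  obtain ⟨x, rfl⟩ := proj_surjective M g
  rw [← coinvClass_conjNormal M G hg (conjSq M y' s'), conjNormal_conjSq, coinvClass, coinvClass,
    pureClass_conjSq_eq]
  rw [← (eq_smul_simpleRefl_iff M).1 rfl, ← (eq_smul_simpleRefl_iff M).1 rfl, map_mul, mul_smul]
  exact congrArg Subtype.val hgt.symm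

/-! ### The natural basis of the coinvariants -/

theorem exists_conjSq_of_orbit (o : Orbits M G) :
    ∃ ys : Braid M × S, orbitOf M G (proj M ys.1 • simpleRefl M ys.2) = o := by
  obtain ⟨t, rfl⟩ := Quotient.exists_rep o
  obtain ⟨y, s, rfl⟩ := exists_smul_simpleRefl M t
  exact ⟨⟨y, s⟩, rfl⟩

/-- The class of the elements `y s² y⁻¹` for which the projection of `y s y⁻¹` lies in the
given orbit. -/
noncomputable def orbitClass (o : Orbits M G) : PureCoinv M G :=
  coinvClass M G (conjSq M (exists_conjSq_of_orbit M G o).choose.1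
    (exists_conjSq_of_orbit M G o).choose.2)

theorem orbitClass_eq (y : Braid M) (s : S) :
    orbitClass M G (orbitOf M G (proj M y • simpleRefl M s)) = coinvClass M G (conjSq M y s) :=
  coinvClass_conjSq_eq M G (exists_conjSq_of_orbit M G _).choose_spec

theorem coinvCross_orbitClass (o : Orbits M G) :
    coinvCross M G (orbitClass M G o) = Finsupp.single o 2 := by
  rw [orbitClass, coinvCross_coinvClass, orbitCross_conjSq,
    (exists_conjSq_of_orbit M G o).choose_spec]

theorem linearIndependent_orbitClass : LinearIndependent ℤ (orbitClass M G) := by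
  apply LinearIndependent.of_comp (coinvCross M G)
  have e : ⇑(coinvCross M G) ∘ orbitClass M G = fun o => Finsupp.single o 2 :=
    funext (coinvCross_orbitClass M G)
  rw [e]
  exact Finsupp.linearIndependent_single_of_ne_zero fun _ => two_ne_zero

theorem span_orbitClass : ⊤ ≤ Submodule.span ℤ (Set.range (orbitClass M G)) := by
  rintro A -
  obtain ⟨B, rfl⟩ := Representation.Coinvariants.mk_surjective _ A
  obtain ⟨p, rfl⟩ := exists_pureClass_eq M B
  change coinvClass M G p ∈ _
  obtain ⟨x, hx⟩ := p
  obtain ⟨hx', h⟩ : ∃ hx : x ∈ PureBraid M,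
      coinvClass M G ⟨x, hx⟩ ∈ Submodule.span ℤ (Set.range (orbitClass M G)) := by
    refine pureBraid_induction M (p := fun x => ∃ hx : x ∈ PureBraid M,
      coinvClass M G ⟨x, hx⟩ ∈ Submodule.span ℤ (Set.range (orbitClass M G)))
      (fun y s => ?_) ?_ ?_ ?_ hx
    · refine ⟨(conjSq M y s).2, ?_⟩
      change coinvClass M G (conjSq M y s) ∈ _
      rw [← orbitClass_eq]
      exact Submodule.subset_span ⟨_, rfl⟩
    · exact ⟨one_mem _, (coinvClass_one M G).symm ▸ zero_mem _⟩
    · rintro x y hx hy ⟨_, px⟩ ⟨_, py⟩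
      exact ⟨mul_mem hx hy, (coinvClass_mul M G ⟨x, hx⟩ ⟨y, hy⟩).symm ▸ add_mem px py⟩
    · rintro x hx ⟨_, px⟩
      exact ⟨inv_mem hx, (coinvClass_inv M G ⟨x, hx⟩).symm ▸ neg_mem px⟩
  exact h

/-- The natural basis of the coinvariants. -/
noncomputable def orbitBasis : Module.Basis (Orbits M G) ℤ (PureCoinv M G) :=
  Module.Basis.mk (linearIndependent_orbitClass M G) (span_orbitClass M G)

theorem orbitBasis_apply (o : Orbits M G) : orbitBasis M G o = orbitClass M G o :=
  Module.Basis.mk_apply _ _ _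

theorem isNaturalBasis_orbitBasis : IsNaturalBasis M G (orbitBasis M G) := by
  intro t y s ht
  rw [orbitBasis_apply, (eq_smul_simpleRefl_iff M).2 ht, orbitClass_eq]

/-! ### Products of quasigenerators and commutators over `G` -/

theorem coinvCross_eq_two_smul_repr (A : PureCoinv M G) :
    coinvCross M G A = (2 : ℤ) • (orbitBasis M G).repr A := by
  have e : coinvCross M G = (2 : ℤ) • (orbitBasis M G).repr.toLinearMap :=
    (orbitBasis M G).ext fun o => by
      rw [LinearMap.smul_apply, LinearEquiv.coe_coe, Module.Basis.repr_self, orbitBasis_apply,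
        coinvCross_orbitClass, Finsupp.smul_single, smul_eq_mul, mul_one]
  rw [e]
  rfl

/-- Crossing numbers are twice the coordinates, and `ℤ` has no 2-torsion, so both have the same
support. -/
theorem coinvClass_mem_span_of_support {x : PureBraid M} {O : Set (Orbits M G)}
    (h : ∀ o ∉ O, orbitCross M G x o = 0) :
    coinvClass M G x ∈ Submodule.span ℤ (orbitBasis M G '' O) := by
  rw [Module.Basis.mem_span_image]
  intro o ho
  by_contra hO
  have e := h o hO
  rw [← coinvCross_coinvClass, coinvCross_eq_two_smul_repr, Finsupp.smul_apply, smul_eq_mul] at e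
  rw [Finset.mem_coe, Finsupp.mem_support_iff] at ho
  omega

/-- The orbits of the quasireflections that lie in `G`. -/
def innerOrbits : Set (Orbits M G) := {o | ∃ t : Quasireflection M, t.1 ∈ G ∧ o = orbitOf M G t}

theorem orbitCross_quasigenerator_apply {x : Braid M} (hx : IsQuasigenerator M x)
    (hG : proj M x ∈ G) {o : Orbits M G} (ho : o ∉ innerOrbits M G) :
    orbitCross M G x o = 0 := by
  obtain ⟨y, s, rfl⟩ := hx
  have ht := (eq_smul_simpleRefl_iff M (t := proj M y • simpleRefl M s)).1 rfl
  rw [orbitCross_quasigenerator M G ht (ht ▸ hG)]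
  refine Finsupp.single_eq_of_ne ?_
  rintro rfl
  exact ho ⟨_, ht ▸ hG, rfl⟩

theorem orbitCross_prod_quasigenerators {L : List (Braid M × ℤˣ)}
    (hL : ∀ p ∈ L, IsQuasigenerator M p.1 ∧ proj M p.1 ∈ G) :
    proj M (L.map fun p => p.1 ^ (p.2 : ℤ)).prod ∈ G ∧ ∀ o ∉ innerOrbits M G,
      orbitCross M G (L.map fun p => p.1 ^ (p.2 : ℤ)).prod o = 0 := by
  induction L with
  | nil => simp [orbitCross_one]
  | cons p L ih =>
    obtain ⟨ihG, ih⟩ := ih fun q hq => hL q (List.mem_cons_of_mem p hq)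
    obtain ⟨hq, hG⟩ := hL p List.mem_cons_self
    have hG' : proj M (p.1 ^ (p.2 : ℤ)) ∈ G := by rw [map_zpow]; exact zpow_mem hG _
    rw [List.map_cons, List.prod_cons]
    refine ⟨by rw [map_mul]; exact mul_mem hG' ihG, fun o ho => ?_⟩
    rw [orbitCross_mul M G hG', Finsupp.add_apply, ih o ho, add_zero]
    have h0 := orbitCross_quasigenerator_apply M G hq hG ho
    rcases Int.units_eq_one_or p.2 with h | h <;> rw [h]
    · simpa using h0
    · simpa [orbitCross_inv M G hG] using h0

theorem orbitCross_prod_commutators {C : List (Braid M × Braid M)}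
    (hC : ∀ c ∈ C, proj M c.1 ∈ G ∧ proj M c.2 ∈ G) :
    orbitCross M G (C.map fun c => c.1 * c.2 * c.1⁻¹ * c.2⁻¹).prod = 0 := by
  induction C with
  | nil => simp [orbitCross_one]
  | cons c C ih =>
    obtain ⟨h1, h2⟩ := hC c List.mem_cons_self
    have hc : proj M (c.1 * c.2 * c.1⁻¹ * c.2⁻¹) ∈ G := by
      simp only [map_mul, map_inv]
      exact mul_mem (mul_mem (mul_mem h1 h2) (inv_mem h1)) (inv_mem h2)
    rw [List.map_cons, List.prod_cons, orbitCross_mul M G hc, orbitCross_commutator M G h1 h2,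
      ih fun q hq => hC q (List.mem_cons_of_mem c hq), add_zero]

end Reflections

end ArtinBraid

theorem mainTheorem7 {S : Type*} [Finite S] (M : CoxeterMatrix S) (G : Subgroup M.Group) :
    ∃ A : Module.Basis (ArtinBraid.Orbits M G) ℤ (ArtinBraid.PureCoinv M G),
      ArtinBraid.IsNaturalBasis M G A ∧
      ∀ (x : ArtinBraid.PureBraid M) (L : List (ArtinBraid.Braid M × ℤˣ))
        (C : List (ArtinBraid.Braid M × ArtinBraid.Braid M)),
        (∀ p ∈ L, ArtinBraid.IsQuasigenerator M p.1 ∧ ArtinBraid.proj M p.1 ∈ G) →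
        (∀ c ∈ C, ArtinBraid.proj M c.1 ∈ G ∧ ArtinBraid.proj M c.2 ∈ G) →
        (x : ArtinBraid.Braid M) =
          (L.map fun p => p.1 ^ (p.2 : ℤ)).prod * (C.map fun c => c.1 * c.2 * c.1⁻¹ * c.2⁻¹).prod →
        ArtinBraid.coinvClass M G x ∈
          Submodule.span ℤ (A '' {o | ∃ t : ArtinBraid.Quasireflection M,
            t.1 ∈ G ∧ o = ArtinBraid.orbitOf M G t}) := by
  refine ⟨ArtinBraid.orbitBasis M G, ArtinBraid.isNaturalBasis_orbitBasis M G,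
    fun x L C hL hC hx => ?_⟩
  obtain ⟨hG, h0⟩ := ArtinBraid.orbitCross_prod_quasigenerators M G hL
  refine ArtinBraid.coinvClass_mem_span_of_support M G (O := ArtinBraid.innerOrbits M G)
    fun o ho => ?_
  rw [hx, ArtinBraid.orbitCross_mul M G hG, ArtinBraid.orbitCross_prod_commutators M G hC, add_zero,
    h0 o ho]
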